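/- Let $\mathcal H$ be a real Hilbert space, $L>0$, and let $F:\mathcal H\to\mathcal H$ be $(1/L)$-cocoercive, i.e. $\langle x-y,F(x)-F(y)\rangle\ge \frac1L\|F(x)-F(y)\|^2$ for all $x,y\in\mathcal H$. Let $B:\mathcal H\rightrightarrows\mathcal H$ be a maximal monotone operator and $C\subset\mathcal H$ a nonempty closed convex set containing the domain $\{x: B(x)\ne\emptyset\}$ of $B$. Assume that the solution set $\mathcal S=\{x : 0\in F(x)+B(x)\}$ is nonempty. For $\varepsilon\ge0$ let $F^{\varepsilon}(x)=\{v:\langle F(y)-v,\,y-x\rangle\ge-\varepsilon\ \text{for all } y\in\mathcal H\}$, and let $P_D$ denote the orthogonal projection onto a nonempty closed convex set $D$. Let $x_0=x_{-1}\in\mathcal H$, $\sigma\in(0,1)$ and $\lambda=2\sigma^2/L$, and let the sequences $(x_k)$, $(y_k)$, $(v_k)$, $(\varepsilon_k)$ be generated, for $k=0,1,2,\dots$, by the inertial forward-backward algorithm $$w_k=x_k+\alpha_k(x_k-x_{k-1}),\qquad \widetilde w_k=w_k+\beta_k(w_k-x_0),\qquad w_k'=P_C(\widetilde w_k),$$ $$y_k=(\lambda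 B+I)^{-1}\big(\widetilde w_k-\lambda F(w_k')\big),\qquad v_k=\frac{\widetilde w_k-y_k}{\lambda},\qquad \varepsilon_k=\frac{\|y_k-w_k'\|^2}{4L^{-1}},$$ $$H_k=\{z:\langle z-y_k,v_k\rangle\le\varepsilon_k\},\qquad W_k=\{z:\langle z-x_k,x_0-x_k\rangle\le0\},\qquad x_{k+1}=P_{H_k\cap W_k}(x_0),$$ where $\alpha_k,\beta_k\ge0$ satisfy $\overline\alpha:=\sup_k\alpha_k<\infty$ and $\overline s:=\sum_{k=0}^\infty\beta_k^2<\infty$; put $\overline\beta:=\sup_k\beta_k$. Let $d_0$ be the distance from $x_0$ to $\mathcal S$. Then: (a) $(x_k)$ and $(y_k)$ converge strongly to $P_{\mathcal S}(x_0)$. (b) For every $k\ge0$ there is $j\in\{0,\dots,k\}$ such that $v_j\in(F^{\varepsilon_j}+B)(y_j)$, $$\|v_j\|\le\frac{2d_0L}{\sqrt{k+1}}\cdot\frac{\sqrt{(1+\overline\alpha)\left[(1+\overline\beta)\left(1+\overline\alpha(1+\overline\beta)\right)+\overline s\right]}}{2(1-\sigma^2)\sigma^2},$$ $$\varepsilon_j\le\frac{d_0^2L}{k+1}\cdot\frac{4\sigma^2(1+\overline\alpha)\left[(1+\overline\beta)\left(1+\overline\alpha(1+\overline\beta)\right)+\overline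 s\right]}{2(1-\sigma^2)^2\sigma^2}.$$ -/

import Mathlib

open Filter Topology
open scoped Pointwise

/- Set-valued maps on `H` are functions `H → Set H`. Their sum `T + S` and their scalar multiples
`c • T` are Mathlib's pointwise ones: `(T + S) x = {u + v | u ∈ T x, v ∈ S x}` and
`(c • T) x = {c • v | v ∈ T x}`. -/

namespace InertialFB

variable {H : Type*}

/-- A single-valued map, regarded as a set-valued one. -/
def single (F : H → H) : H → Set H := fun x => {F x}

/-- The inverse of a set-valued map: `x ∈ T⁻¹ v` if and only if `v ∈ T x`. -/
def inverse (T : H → Set H) : H → Set H := fun v => {x | v ∈ T x}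

/-- The effective domain of a set-valued map. -/
def dom (T : H → Set H) : Set H := {x | (T x).Nonempty}

variable [NormedAddCommGroup H] [InnerProductSpace ℝ H]

/-- The set of zeros `T⁻¹(0)`. -/
def zeros (T : H → Set H) : Set H := inverse T 0

/-- Monotone set-valued maps. -/
def IsMonotone (T : H → Set H) : Prop :=
  ∀ x y : H, ∀ u ∈ T x, ∀ v ∈ T y, 0 ≤ inner ℝ (x - y) (u - v)

/-- Maximal monotone set-valued maps: monotone, and the graph is not properly contained in the
graph of another monotone map. -/
def IsMaximalMonotone (T : H → Set H) : Prop :=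
  IsMonotone T ∧ ∀ T' : H → Set H, IsMonotone T' → (∀ x, T x ⊆ T' x) → T' = T

/-- The `ε`-enlargement of a set-valued map. -/
def enlargement (T : H → Set H) (ε : ℝ) : H → Set H := fun x =>
  {v | ∀ y : H, ∀ u ∈ T y, inner ℝ (u - v) (y - x) ≥ -ε}

/-- The resolvent `(c T + I)⁻¹`, as a set-valued map. -/
def resolventMap (c : ℝ) (T : H → Set H) : H → Set H := inverse (c • T + single id)

/-- `p` is a point of `C` nearest to `x`; if `C` is nonempty, closed and convex (in a Hilbert space)
there is exactly one such point, the orthogonal projection `P_C(x)`. -/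
def IsProj (C : Set H) (x p : H) : Prop :=
  p ∈ C ∧ ∀ z ∈ C, ‖x - p‖ ≤ ‖x - z‖

/-- `F` is defined on all of `H` and is `(1/L)`-cocoercive. -/
def IsCocoercive (F : H → H) (L : ℝ) : Prop :=
  ∀ x y : H, inner ℝ (x - y) (F x - F y) ≥ 1 / L * ‖F x - F y‖ ^ 2

/-- The half-space `{z | ⟨z - y, v⟩ ≤ ε}`. -/
def halfSpace (y v : H) (ε : ℝ) : Set H := {z | inner ℝ (z - y) v ≤ ε}

/-- The sequences are produced by the inertial forward-backward algorithm with starting point `x 0`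
and step size `lam`. -/
structure IsRun (F : H → H) (B : H → Set H) (C : Set H) (L lam : ℝ) (α β : ℕ → ℝ)
    (x w wt w' y v : ℕ → H) (ε : ℕ → ℝ) : Prop where
  alpha_nonneg : ∀ k, 0 ≤ α k
  beta_nonneg : ∀ k, 0 ≤ β k
  /- For `k = 0` the subtraction in `ℕ` truncates, so `x (0 - 1) = x 0`: this is the convention
  that the point `x_{-1}` equals `x_0`. -/
  w_eq : ∀ k, w k = x k + α k • (x k - x (k - 1))
  wt_eq : ∀ k, wt k = w k + β k • (w k - x 0)
  w'_proj : ∀ k, IsProj C (wt k) (w' k)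
  y_mem : ∀ k, y k ∈ resolventMap lam B (wt k - lam • F (w' k))
  v_eq : ∀ k, v k = (1 / lam) • (wt k - y k)
  ε_eq : ∀ k, ε k = ‖y k - w' k‖ ^ 2 / (4 * L⁻¹)
  x_succ : ∀ k, IsProj (halfSpace (y k) (v k) (ε k) ∩ halfSpace (x k) (x 0 - x k) 0)
    (x 0) (x (k + 1))

/-- The constant `(1 + a) [(1 + b) (1 + a (1 + b)) + s]` of the complexity bounds. -/
def boundConst (a b s : ℝ) : ℝ := (1 + a) * ((1 + b) * (1 + a * (1 + b)) + s)

end InertialFB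

namespace InertialFB

variable {H : Type*} [NormedAddCommGroup H] [InnerProductSpace ℝ H]

/-! ### Projections onto convex sets -/

/-! Cocoercivity makes the forward evaluation `F (w' k)` an `ε k`-approximate value of `F` at `y k`.
Together with monotonicity of `B` this puts every solution in every `H_k`, and then, by induction
through the projections, in every `W_k`. Hence the iterates stay within `d_0` of `x 0`. Since `x (k
+ 1)` lies in `W_k`, the squared steps telescope to at most `d_0 ^ 2` (`sum_sq_norm_succ_le`).
Square-summability of `β` transfers this to `x (k + 1) - wt k`, and membership of `x (k + 1)` in
`H_k` bounds `wt k - y k` by the latter (`norm_wt_sub_y_le`). A term no larger than the average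
gives (b).

For (a), `F` is constant on the solution set and `F (y k)` converges strongly to that value, so the
elements of `B (y k)` in use also converge strongly. Maximality of `B` then makes weak limits of the
iterates solutions (`weak_limit_mem_zeros`). The bound `‖x k - x 0‖ ≤ d_0` upgrades weak to strong
convergence (`tendsto_x`). -/

theorem convex_halfSpace (y v : H) (ε : ℝ) : Convex ℝ (halfSpace y v ε) := by
  intro a ha b hb s t hs ht hst
  simp only [halfSpace, Set.mem_ofPred_eq] at *
  have h : s • a + t • b - y = s • (a - y) + t • (b - y) := by
    have : y = (s + t) • y := by rw [hst, one_smul]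
    nth_rewrite 1 [this]
    module
  rw [h, inner_add_left, real_inner_smul_left, real_inner_smul_left]
  calc s * inner ℝ (a - y) v + t * inner ℝ (b - y) v ≤ s * ε + t * ε := by gcongr
    _ = ε := by rw [← add_mul, hst, one_mul]

theorem IsProj.norm_eq_iInf {E : Type*} [NormedAddCommGroup E] {C : Set E} {x p : E} (h : IsProj C x p) :
    ‖x - p‖ = ⨅ z : C, ‖x - z‖ := by
  have : Nonempty C := ⟨⟨p, h.1⟩⟩
  refine le_antisymm (le_ciInf fun z => h.2 z z.2) ?_
  exact ciInf_le (f := fun z : C => ‖x - z‖)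
    ⟨0, by rintro _ ⟨z, rfl⟩; exact norm_nonneg _⟩ ⟨p, h.1⟩

/-- The variational inequality that characterizes projections. -/
theorem IsProj.inner_le_zero {C : Set H} {x p : H} (h : IsProj C x p) (hC : Convex ℝ C)
    {z : H} (hz : z ∈ C) : inner ℝ (x - p) (z - p) ≤ 0 :=
  (norm_eq_iInf_iff_real_inner_le_zero hC h.1).1 h.norm_eq_iInf z hz

theorem IsProj.norm_sub_le {C : Set H} {x p : H} (h : IsProj C x p) (hC : Convex ℝ C)
    {z : H} (hz : z ∈ C) : ‖z - p‖ ≤ ‖z - x‖ := by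
  have h1 := h.inner_le_zero hC hz
  have h2 : ‖z - x‖ ^ 2 = ‖z - p‖ ^ 2 - 2 * inner ℝ (x - p) (z - p) + ‖x - p‖ ^ 2 := by
    rw [show z - x = (z - p) - (x - p) by abel, norm_sub_sq_real, real_inner_comm]
  exact abs_le_of_sq_le_sq' (by nlinarith [sq_nonneg ‖x - p‖]) (norm_nonneg _) |>.2

theorem IsProj.infDist_eq {E : Type*} [NormedAddCommGroup E] {C : Set E}
    {x p : E} (h : IsProj C x p) :
    Metric.infDist x C = ‖x - p‖ := by
  refine le_antisymm ?_ ?_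
  · rw [← dist_eq_norm]
    exact Metric.infDist_le_dist_of_mem h.1
  · refine (Metric.le_infDist ⟨p, h.1⟩).2 fun z hz => ?_
    rw [dist_eq_norm]
    exact h.2 z hz

theorem IsProj.eq {C : Set H} {x p q : H} (hC : Convex ℝ C) (hp : IsProj C x p)
    (hq : IsProj C x q) : p = q := by
  have h1 := hp.inner_le_zero hC hq.1
  have h2 := hq.inner_le_zero hC hp.1
  have h3 : ‖p - q‖ ^ 2 = inner ℝ (x - p) (q - p) + inner ℝ (x - q) (p - q) := by
    rw [← real_inner_self_eq_norm_sq, show q - p = -(p - q) by abel, inner_neg_right,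
      show p - q = (x - q) - (x - p) by abel, inner_sub_left]
    ring
  have h4 : ‖p - q‖ = 0 := by
    nlinarith [norm_nonneg (p - q)]
  exact sub_eq_zero.1 (norm_eq_zero.1 h4)

theorem existsUnique_isProj [CompleteSpace H] {C : Set H} (hne : C.Nonempty) (hcl : IsClosed C)
    (hC : Convex ℝ C) (x : H) : ∃! p, IsProj C x p := by
  obtain ⟨p, hp, h⟩ := exists_norm_eq_iInf_of_complete_convex hne hcl.isComplete hC x
  have hproj : IsProj C x p := ⟨hp, fun z hz => by
    rw [h]
    exact ciInf_le (f := fun z : C => ‖x - z‖)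
      ⟨0, by rintro _ ⟨z, rfl⟩; exact norm_nonneg _⟩ ⟨z, hz⟩⟩
  exact ⟨p, hproj, fun q hq => IsProj.eq hC hq hproj⟩

/-! ### Cocoercive and maximal monotone maps -/

/-- Adjoining the single pair `(z, c)` to the graph keeps it monotone, so maximality forces the pair
to be there already. -/
theorem IsMaximalMonotone.mem {B : H → Set H} (hB : IsMaximalMonotone B) {z c : H}
    (h : ∀ u : H, ∀ b ∈ B u, 0 ≤ inner ℝ (u - z) (b - c)) : c ∈ B z := by
  have hT := hB.2 (fun x => B x ∪ {v | x = z ∧ v = c}) ?_ fun x => Set.subset_union_left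
  · rw [← hT]
    exact Or.inr ⟨rfl, rfl⟩
  · rintro x y u (hu | ⟨rfl, rfl⟩) v (hv | ⟨rfl, rfl⟩)
    · exact hB.1 x y u hu v hv
    · exact h x u hu
    · have := h y v hv
      rwa [← neg_sub y, ← neg_sub v, inner_neg_neg]
    · simp

theorem IsCocoercive.norm_sub_le {F : H → H} {L : ℝ} (hL : 0 < L) (hF : IsCocoercive F L)
    (x y : H) : ‖F x - F y‖ ≤ L * ‖x - y‖ := by
  have h1 := hF x y
  have h2 := real_inner_le_norm (x - y) (F x - F y)
  by_contra! hlt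
  have hpos : 0 < ‖F x - F y‖ := lt_of_le_of_lt (by positivity) hlt
  have h3 : ‖F x - F y‖ ^ 2 ≤ L * (‖x - y‖ * ‖F x - F y‖) := by
    rw [ge_iff_le, one_div, inv_mul_le_iff₀ hL] at h1
    nlinarith
  nlinarith

theorem IsCocoercive.continuous {F : H → H} {L : ℝ} (hL : 0 < L) (hF : IsCocoercive F L) :
    Continuous F := by
  refine (LipschitzWith.of_dist_le_mul (K := ⟨L, hL.le⟩) fun x y => ?_).continuous
  rw [dist_eq_norm, dist_eq_norm]
  exact hF.norm_sub_le hL x y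

/-- A value of a cocoercive map at a nearby point lies in the enlargement. -/
theorem IsCocoercive.mem_enlargement {F : H → H} {L : ℝ} (hL : 0 < L) (hF : IsCocoercive F L)
    (y z : H) : F z ∈ enlargement (single F) (‖y - z‖ ^ 2 / (4 * L⁻¹)) y := by
  rintro q _ rfl
  have h1 := hF q z
  have h2 := real_inner_le_norm (F q - F z) (y - z)
  have h3 : inner ℝ (F q - F z) (q - y) =
      inner ℝ (q - z) (F q - F z) - inner ℝ (F q - F z) (y - z) := by
    rw [real_inner_comm (F q - F z) (q - z), ← inner_sub_right]
    congr 1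
    abel
  have h4 : ‖y - z‖ ^ 2 / (4 * L⁻¹) = L * ‖y - z‖ ^ 2 / 4 := by
    field_simp
  -- Completing the square absorbs the Cauchy–Schwarz cross term into the cocoercivity term; the
  -- remainder is the `L / 4` of `ε k`.
  have h5 : 0 ≤ 1 / L * (‖F q - F z‖ - L * ‖y - z‖ / 2) ^ 2 := by positivity
  have h6 : 1 / L * (‖F q - F z‖ - L * ‖y - z‖ / 2) ^ 2 =
      1 / L * ‖F q - F z‖ ^ 2 - ‖F q - F z‖ * ‖y - z‖ + L * ‖y - z‖ ^ 2 / 4 := by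
    field_simp
    ring
  rw [h3, h4]
  linarith

theorem mem_zeros_iff {E : Type*} [NormedAddCommGroup E] {F : E → E}
    {B : E → Set E} {z : E} :
    z ∈ zeros (single F + B) ↔ -F z ∈ B z := by
  change (0 : E) ∈ (single F z + B z) ↔ _
  rw [single, Set.singleton_add, Set.mem_image]
  constructor
  · rintro ⟨b, hb, h⟩
    rwa [← eq_neg_of_add_eq_zero_right h]
  · exact fun h => ⟨_, h, by abel⟩

theorem eq_of_mul_sq_norm_sub_nonpos {E : Type*} [NormedAddCommGroup E] {L : ℝ} (hL : 0 < L)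
    {a b : E} (h : 1 / L * ‖a - b‖ ^ 2 ≤ 0) : a = b := by
  rw [one_div, inv_mul_le_iff₀ hL, mul_zero] at h
  exact sub_eq_zero.1 (norm_eq_zero.1 ((pow_eq_zero_iff two_ne_zero).1
    (le_antisymm h (sq_nonneg _))))

theorem IsCocoercive.eq_of_inner_nonpos {F : H → H} {L : ℝ} (hL : 0 < L) (hF : IsCocoercive F L)
    {x y : H} (h : inner ℝ (x - y) (F x - F y) ≤ 0) : F x = F y := by
  have h1 : 1 / L * ‖F x - F y‖ ^ 2 ≤ 0 := (hF x y).trans h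
  exact eq_of_mul_sq_norm_sub_nonpos hL h1

theorem isClosed_zeros {F : H → H} {B : H → Set H} {L : ℝ} (hL : 0 < L) (hF : IsCocoercive F L)
    (hB : IsMaximalMonotone B) : IsClosed (zeros (single F + B)) := by
  have h : zeros (single F + B) =
      ⋂ (u : H) (b ∈ B u), {z | 0 ≤ inner ℝ (u - z) (b - -F z)} := by
    ext z
    simp only [Set.mem_iInter, Set.mem_ofPred_eq, mem_zeros_iff]
    exact ⟨fun hz u b hb => hB.1 u z b hb _ hz, fun h => hB.mem h⟩
  rw [h]
  have hc := hF.continuous hL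
  refine isClosed_iInter fun u => isClosed_iInter fun b => isClosed_iInter fun _ => ?_
  exact isClosed_le continuous_const (by fun_prop)

/-- Monotonicity of `B` at `-F z`, `-F z'` gives the inner product in the cocoercivity inequality
the opposite sign. -/
theorem eq_of_mem_zeros {F : H → H} {B : H → Set H} {L : ℝ} (hL : 0 < L)
    (hF : IsCocoercive F L) (hB : IsMonotone B) {z z' : H}
    (hz : z ∈ zeros (single F + B)) (hz' : z' ∈ zeros (single F + B)) : F z = F z' := by
  rw [mem_zeros_iff] at hz hz'
  refine hF.eq_of_inner_nonpos hL ?_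
  have h := hB z z' _ hz _ hz'
  rw [show -F z - -F z' = -(F z - F z') by abel, inner_neg_right] at h
  linarith

theorem convex_zeros {F : H → H} {B : H → Set H} {L : ℝ} (hL : 0 < L) (hF : IsCocoercive F L)
    (hB : IsMaximalMonotone B) : Convex ℝ (zeros (single F + B)) := by
  intro a ha b hb s t hs ht hst
  have hab : F a = F b := eq_of_mem_zeros hL hF hB.1 ha hb
  set z := s • a + t • b with hz
  have hcomb : ∀ q c : H, inner ℝ (q - z) c = s * inner ℝ (q - a) c + t * inner ℝ (q - b) c := by
    intro q c
    rw [← real_inner_smul_left, ← real_inner_smul_left, ← inner_add_left]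
    congr 1
    have : q = (s + t) • q := by rw [hst, one_smul]
    nth_rewrite 1 [this]
    rw [hz]
    module
  -- The cocoercivity inequalities at `(z, a)` and `(z, b)`, averaged with weights `s`, `t`, have
  -- left-hand side `⟨z - z, F z - F a⟩ = 0`.
  have hFz : F z = F a := by
    have h1 := hF z a
    have h2 := hF z b
    rw [← hab] at h2
    have h3 := hcomb z (F z - F a)
    rw [sub_self, inner_zero_left] at h3
    have h4 : 1 / L * ‖F z - F a‖ ^ 2 ≤ 0 := by
      have : 1 / L * ‖F z - F a‖ ^ 2 = s * (1 / L * ‖F z - F a‖ ^ 2) +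
          t * (1 / L * ‖F z - F a‖ ^ 2) := by rw [← add_mul, hst, one_mul]
      nlinarith [mul_le_mul_of_nonneg_left h1 hs, mul_le_mul_of_nonneg_left h2 ht]
    exact eq_of_mul_sq_norm_sub_nonpos hL h4
  rw [mem_zeros_iff] at ha hb ⊢
  refine hB.mem fun u c hc => ?_
  have h1 := hB.1 u a c hc _ ha
  have h2 := hB.1 u b c hc _ hb
  rw [← hab] at h2
  rw [hFz, hcomb]
  positivity

/-! ### Weak limits along ultrafilters -/

/-- Banach–Alaoglu transported through the Riesz isometry. An ultrafilter takes the place of a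
weakly convergent subsequence. -/
theorem exists_weak_limit [CompleteSpace H] {ι : Type*} (𝒰 : Ultrafilter ι) (x : ι → H) (R : ℝ)
    (hx : ∀ i, ‖x i‖ ≤ R) :
    ∃ a : H, ∀ h : H, Tendsto (fun i => inner ℝ (x i) h) 𝒰 (𝓝 (inner ℝ a h)) := by
  let f : ι → WeakDual ℝ H := fun i =>
    StrongDual.toWeakDual (InnerProductSpace.toDual ℝ H (x i))
  have hK := WeakDual.isCompact_closedBall (𝕜 := ℝ) (E := H) 0 R
  obtain ⟨φ, -, hφ⟩ := hK.ultrafilter_le_nhds (𝒰.map f) (by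
    rw [Filter.le_principal_iff]
    refine Filter.mem_map.2 (Filter.univ_mem' fun i => ?_)
    simpa [f] using hx i)
  refine ⟨(InnerProductSpace.toDual ℝ H).symm (WeakDual.toStrongDual φ), fun h => ?_⟩
  have h1 : Tendsto f 𝒰 (𝓝 φ) := hφ
  have h2 := ((WeakDual.eval_continuous (𝕜 := ℝ) (E := H) h).tendsto φ).comp h1
  rw [InnerProductSpace.toDual_symm_apply]
  exact h2

/-- The inner product of a bounded weakly convergent family with a strongly convergent one. -/
theorem tendsto_inner_of_weak {ι : Type*} {l : Filter ι} {x r : ι → H} {a c : H} {R : ℝ}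
    (hx : ∀ i, ‖x i‖ ≤ R)
    (hw : ∀ h : H, Tendsto (fun i => inner ℝ (x i) h) l (𝓝 (inner ℝ a h)))
    (hr : Tendsto r l (𝓝 c)) :
    Tendsto (fun i => inner ℝ (x i) (r i)) l (𝓝 (inner ℝ a c)) := by
  have h1 : Tendsto (fun i => inner ℝ (x i) (r i - c)) l (𝓝 0) := by
    have h2 : Tendsto (fun i => R * ‖r i - c‖) l (𝓝 0) := by
      simpa using (tendsto_iff_norm_sub_tendsto_zero.1 hr).const_mul R
    refine squeeze_zero_norm (fun i => ?_) h2
    exact (norm_inner_le_norm _ _).trans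
      (mul_le_mul_of_nonneg_right (hx i) (norm_nonneg _))
  have h3 := h1.add (hw c)
  rw [zero_add] at h3
  refine h3.congr fun i => ?_
  rw [← inner_add_right, sub_add_cancel]

end InertialFB

namespace InertialFB

variable {H : Type*} [NormedAddCommGroup H] [InnerProductSpace ℝ H]

/-! ### One step of the algorithm -/

namespace IsRun

variable {F : H → H} {B : H → Set H} {C : Set H} {L σ lam : ℝ} {α β : ℕ → ℝ}
  {x w wt w' y v : ℕ → H} {ε : ℕ → ℝ}

theorem exists_mem (h : IsRun F B C L lam α β x w wt w' y v ε) (hlam : lam ≠ 0) (k : ℕ) :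
    ∃ b ∈ B (y k), v k = F (w' k) + b := by
  have hy := h.y_mem k
  change wt k - lam • F (w' k) ∈ lam • B (y k) + {y k} at hy
  rw [Set.add_singleton] at hy
  obtain ⟨_, ⟨b, hb, rfl⟩, hbe⟩ := hy
  refine ⟨b, hb, ?_⟩
  have h1 : wt k - y k = lam • (F (w' k) + b) := by
    have h2 : lam • b + y k = wt k - lam • F (w' k) := hbe
    rw [smul_add, sub_eq_iff_eq_add, add_assoc, h2]
    abel
  rw [h.v_eq, h1, smul_smul, one_div, inv_mul_cancel₀ hlam, one_smul]

theorem mem_enlargement_add (h : IsRun F B C L lam α β x w wt w' y v ε) (hlam : lam ≠ 0)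
    (hL : 0 < L) (hF : IsCocoercive F L) (k : ℕ) :
    v k ∈ (enlargement (single F) (ε k) + B) (y k) := by
  obtain ⟨b, hb, hv⟩ := h.exists_mem hlam k
  rw [hv, h.ε_eq]
  exact Set.add_mem_add (hF.mem_enlargement hL _ _) hb

theorem mem_halfSpace (h : IsRun F B C L lam α β x w wt w' y v ε) (hlam : lam ≠ 0)
    (hL : 0 < L) (hF : IsCocoercive F L) (hB : IsMonotone B) {z : H}
    (hz : z ∈ zeros (single F + B)) (k : ℕ) : z ∈ halfSpace (y k) (v k) (ε k) := by
  obtain ⟨b, hb, hv⟩ := h.exists_mem hlam k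
  have h1 := hF.mem_enlargement hL (y k) (w' k) z (F z) rfl
  rw [← h.ε_eq] at h1
  have h2 := hB z (y k) _ (mem_zeros_iff.1 hz) b hb
  change inner ℝ (z - y k) (v k) ≤ ε k
  rw [real_inner_comm] at h1
  -- The two terms are controlled by the enlargement inequality and by monotonicity of `B`.
  have h3 : inner ℝ (z - y k) (v k) =
      -inner ℝ (z - y k) (F z - F (w' k)) - inner ℝ (z - y k) (-F z - b) := by
    rw [← inner_neg_right, ← inner_sub_right, hv]
    congr 1
    abel
  linarith

/-- Every set contained in all the half-spaces `H_k` is contained in all the half-spaces `W_k`. -/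
theorem mem_halfSpace_start (h : IsRun F B C L lam α β x w wt w' y v ε) {z : H}
    (hz : ∀ k, z ∈ halfSpace (y k) (v k) (ε k)) (k : ℕ) :
    z ∈ halfSpace (x k) (x 0 - x k) 0 := by
  induction k with
  | zero => simp [halfSpace]
  | succ k ih =>
    -- The inequality defining `W_{k+1}` is the variational inequality of the projection that
    -- produces `x (k + 1)`.
    have := (h.x_succ k).inner_le_zero ((convex_halfSpace _ _ _).inter (convex_halfSpace _ _ _))
      ⟨hz k, ih⟩
    change inner ℝ (z - x (k + 1)) (x 0 - x (k + 1)) ≤ 0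
    rwa [real_inner_comm]

theorem norm_sub_start_le (h : IsRun F B C L lam α β x w wt w' y v ε) {z : H}
    (hz : ∀ k, z ∈ halfSpace (y k) (v k) (ε k)) (k : ℕ) : ‖x k - x 0‖ ≤ ‖x 0 - z‖ := by
  cases k with
  | zero => simp
  | succ k =>
    rw [norm_sub_rev]
    exact (h.x_succ k).2 z ⟨hz k, h.mem_halfSpace_start hz k⟩

/-- Membership of `x (k + 1)` in `W_k` makes the angle at `x k` towards `x 0` and `x (k + 1)`
non-acute. -/
theorem sq_norm_succ_le (h : IsRun F B C L lam α β x w wt w' y v ε) (k : ℕ) :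
    ‖x (k + 1) - x k‖ ^ 2 ≤ ‖x (k + 1) - x 0‖ ^ 2 - ‖x k - x 0‖ ^ 2 := by
  have h1 : inner ℝ (x (k + 1) - x k) (x 0 - x k) ≤ 0 := (h.x_succ k).1.2
  rw [show x (k + 1) - x 0 = (x (k + 1) - x k) - (x 0 - x k) by abel,
    norm_sub_sq_real (x (k + 1) - x k) (x 0 - x k), norm_sub_rev (x k) (x 0)]
  linarith

theorem sum_sq_norm_succ_le (h : IsRun F B C L lam α β x w wt w' y v ε) {z : H}
    (hz : ∀ k, z ∈ halfSpace (y k) (v k) (ε k)) (n : ℕ) :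
    ∑ k ∈ Finset.range n, ‖x (k + 1) - x k‖ ^ 2 ≤ ‖x 0 - z‖ ^ 2 := by
  calc ∑ k ∈ Finset.range n, ‖x (k + 1) - x k‖ ^ 2
      ≤ ∑ k ∈ Finset.range n, (‖x (k + 1) - x 0‖ ^ 2 - ‖x k - x 0‖ ^ 2) :=
        Finset.sum_le_sum fun k _ => h.sq_norm_succ_le k
    _ = ‖x n - x 0‖ ^ 2 := by
        rw [Finset.sum_range_sub (fun k => ‖x k - x 0‖ ^ 2)]
        simp
    _ ≤ ‖x 0 - z‖ ^ 2 := by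
        gcongr
        exact h.norm_sub_start_le hz n

/-- The point `y k` lies in `dom B`, hence in `C`, and projecting onto `C` brings `wt k` no farther
from points of `C`. -/
theorem norm_y_sub_w'_le (h : IsRun F B C L lam α β x w wt w' y v ε) (hlam : lam ≠ 0)
    (hC : Convex ℝ C) (hBC : dom B ⊆ C) (k : ℕ) : ‖y k - w' k‖ ≤ ‖wt k - y k‖ := by
  obtain ⟨b, hb, -⟩ := h.exists_mem hlam k
  rw [norm_sub_rev (wt k)]
  exact (h.w'_proj k).norm_sub_le hC (hBC ⟨b, hb⟩)

/-- The choice of step size makes `λ ε k` at most `σ ^ 2 / 2` times `‖wt k - y k‖ ^ 2`. Inserting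
this in the inequality of `H_k` and applying Cauchy–Schwarz leaves the factor `1 - σ ^ 2 / 2`, which
is weakened to `1 - σ ^ 2`. -/
theorem norm_wt_sub_y_le (h : IsRun F B C L (2 * σ ^ 2 / L) α β x w wt w' y v ε)
    (hL : 0 < L) (hσ0 : 0 < σ) (hC : Convex ℝ C) (hBC : dom B ⊆ C) (k : ℕ) :
    (1 - σ ^ 2) * ‖wt k - y k‖ ≤ ‖x (k + 1) - wt k‖ := by
  have hlam : 0 < 2 * σ ^ 2 / L := by positivity
  have hyw := h.norm_y_sub_w'_le hlam.ne' hC hBC k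
  have hε : 2 * σ ^ 2 / L * ε k ≤ σ ^ 2 / 2 * ‖wt k - y k‖ ^ 2 := by
    rw [h.ε_eq, show 2 * σ ^ 2 / L * (‖y k - w' k‖ ^ 2 / (4 * L⁻¹)) =
      σ ^ 2 / 2 * ‖y k - w' k‖ ^ 2 by field_simp; ring]
    gcongr
  have hmem : inner ℝ (x (k + 1) - y k) (v k) ≤ ε k := (h.x_succ k).1.1
  have hv : 2 * σ ^ 2 / L * inner ℝ (x (k + 1) - y k) (v k) =
      inner ℝ (x (k + 1) - wt k) (wt k - y k) + ‖wt k - y k‖ ^ 2 := by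
    rw [← real_inner_smul_right, h.v_eq, smul_smul, mul_one_div_cancel hlam.ne', one_smul,
      ← real_inner_self_eq_norm_sq, ← inner_add_left]
    congr 1
    abel
  have h1 := mul_le_mul_of_nonneg_left hmem hlam.le
  have h2 := neg_le_of_abs_le (abs_real_inner_le_norm (x (k + 1) - wt k) (wt k - y k))
  rcases (norm_nonneg (wt k - y k)).eq_or_lt with h0 | h0
  · rw [← h0, mul_zero]
    exact norm_nonneg _
  · refine le_of_mul_le_mul_right ?_ h0
    nlinarith [mul_nonneg (sq_nonneg σ) (sq_nonneg ‖wt k - y k‖)]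

theorem norm_v_eq (h : IsRun F B C L lam α β x w wt w' y v ε) (hlam : 0 < lam) (k : ℕ) :
    ‖v k‖ = lam⁻¹ * ‖wt k - y k‖ := by
  rw [h.v_eq, norm_smul, Real.norm_of_nonneg (by positivity), one_div]

/-! ### Summability of the residuals -/

theorem wt_sub (h : IsRun F B C L lam α β x w wt w' y v ε) (k : ℕ) :
    x (k + 1) - wt k = (x (k + 1) - x k) - ((1 + β k) * α k) • (x k - x (k - 1)) -
      β k • (x k - x 0) := by
  rw [h.wt_eq, h.w_eq]
  module

end IsRun

theorem sq_norm_sub_smul_sub_smul_le (p q u : H) {c b : ℝ} (hc : 0 ≤ c) :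
    ‖p - c • q - b • u‖ ^ 2 ≤
      2 * (1 + c) * (‖p‖ ^ 2 + c * ‖q‖ ^ 2) + 2 * (b ^ 2 * ‖u‖ ^ 2) := by
  have h1 : ‖p - c • q‖ ^ 2 ≤ (1 + c) * (‖p‖ ^ 2 + c * ‖q‖ ^ 2) := by
    have h2 : 0 ≤ c * ‖p + q‖ ^ 2 := by positivity
    rw [norm_add_sq_real] at h2
    rw [norm_sub_sq_real, real_inner_smul_right, norm_smul, Real.norm_of_nonneg hc]
    nlinarith
  have h3 : ‖p - c • q - b • u‖ ^ 2 ≤ 2 * ‖p - c • q‖ ^ 2 + 2 * ‖b • u‖ ^ 2 := by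
    have h4 := parallelogram_law_with_norm ℝ (p - c • q) (b • u)
    nlinarith [mul_self_nonneg ‖p - c • q + b • u‖]
  have h5 : ‖b • u‖ ^ 2 = b ^ 2 * ‖u‖ ^ 2 := by
    rw [norm_smul, mul_pow, Real.norm_eq_abs, sq_abs]
  rw [h5] at h3
  nlinarith

/-- Ensures that `⨆ i, β i` is a genuine supremum rather than a default value. -/
theorem bddAbove_range_of_summable_sq {β : ℕ → ℝ} (hβ : Summable fun k => β k ^ 2) :
    BddAbove (Set.range β) := by
  refine ⟨1 + ∑' i, β i ^ 2, ?_⟩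
  rintro _ ⟨k, rfl⟩
  have h := hβ.le_tsum k fun _ _ => sq_nonneg _
  nlinarith [sq_nonneg (β k - 1)]

namespace IsRun

variable {F : H → H} {B : H → Set H} {C : Set H} {L σ lam : ℝ} {α β : ℕ → ℝ}
  {x w wt w' y v : ℕ → H} {ε : ℕ → ℝ}

theorem sum_sq_norm_sub_wt_le (h : IsRun F B C L lam α β x w wt w' y v ε) {z : H}
    (hz : ∀ k, z ∈ halfSpace (y k) (v k) (ε k)) (hα : BddAbove (Set.range α))
    (hβ : Summable fun k => β k ^ 2) (n : ℕ) :
    ∑ k ∈ Finset.range n, ‖x (k + 1) - wt k‖ ^ 2 ≤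
      2 * boundConst (⨆ i, α i) (⨆ i, β i) (∑' i, β i ^ 2) * ‖x 0 - z‖ ^ 2 := by
  set a := ⨆ i, α i
  set b := ⨆ i, β i
  set s := ∑' i, β i ^ 2
  set D := ‖x 0 - z‖ ^ 2
  have hαa : ∀ k, α k ≤ a := le_ciSup hα
  have hβb : ∀ k, β k ≤ b := le_ciSup (bddAbove_range_of_summable_sq hβ)
  have ha : 0 ≤ a := (h.alpha_nonneg 0).trans (hαa 0)
  have hb : 0 ≤ b := (h.beta_nonneg 0).trans (hβb 0)
  have hs : 0 ≤ s := tsum_nonneg fun _ => sq_nonneg _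
  have hD : 0 ≤ D := sq_nonneg _
  set c := (1 + b) * a
  have hc : 0 ≤ c := by positivity
  have hterm : ∀ k, ‖x (k + 1) - wt k‖ ^ 2 ≤
      2 * (1 + c) * (‖x (k + 1) - x k‖ ^ 2 + c * ‖x k - x (k - 1)‖ ^ 2) + 2 * (β k ^ 2 * D) := by
    intro k
    have hα0 := h.alpha_nonneg k
    have hβ0 := h.beta_nonneg k
    have hck : (1 + β k) * α k ≤ c := by
      have := hβb k
      exact mul_le_mul (by linarith) (hαa k) hα0 (by positivity)
    have hck0 : 0 ≤ (1 + β k) * α k := by positivity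
    rw [h.wt_sub]
    refine (sq_norm_sub_smul_sub_smul_le _ _ _ hck0).trans ?_
    have hk : ‖x k - x 0‖ ^ 2 ≤ D := pow_le_pow_left₀ (norm_nonneg _) (h.norm_sub_start_le hz k) 2
    gcongr
  have hprev : ∑ k ∈ Finset.range n, ‖x k - x (k - 1)‖ ^ 2 ≤ D := by
    cases n with
    | zero => simpa using hD
    | succ n =>
      -- The term at `0` vanishes because `x (0 - 1) = x 0`, so the shifted sum is again one of
      -- consecutive steps.
      rw [Finset.sum_range_succ']
      simpa using h.sum_sq_norm_succ_le hz n
  have hβs : ∑ k ∈ Finset.range n, β k ^ 2 ≤ s := hβ.sum_le_tsum _ fun _ _ => sq_nonneg _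
  calc ∑ k ∈ Finset.range n, ‖x (k + 1) - wt k‖ ^ 2
      ≤ ∑ k ∈ Finset.range n, (2 * (1 + c) * (‖x (k + 1) - x k‖ ^ 2 +
          c * ‖x k - x (k - 1)‖ ^ 2) + 2 * (β k ^ 2 * D)) :=
        Finset.sum_le_sum fun k _ => hterm k
    _ = 2 * (1 + c) * (∑ k ∈ Finset.range n, ‖x (k + 1) - x k‖ ^ 2 +
          c * ∑ k ∈ Finset.range n, ‖x k - x (k - 1)‖ ^ 2) +
          2 * ((∑ k ∈ Finset.range n, β k ^ 2) * D) := by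
        rw [Finset.sum_add_distrib, ← Finset.mul_sum, Finset.sum_add_distrib, ← Finset.mul_sum,
          ← Finset.mul_sum, Finset.sum_mul]
    _ ≤ 2 * (1 + c) * (D + c * D) + 2 * (s * D) := by
        have := h.sum_sq_norm_succ_le hz n
        gcongr
    _ = 2 * ((1 + c) ^ 2 + s) * D := by ring
    _ ≤ 2 * boundConst a b s * D := by
        -- Enlarging one factor `1 + c`, and `s` to `(1 + a) * s`, produces exactly `boundConst`.
        have h1 : 1 + c ≤ (1 + a) * (1 + b) := by
          simp only [c]
          nlinarith
        have h2 : (1 + c) ^ 2 ≤ (1 + a) * (1 + b) * (1 + c) := by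
          rw [sq]
          gcongr
        have h3 : s ≤ (1 + a) * s := by nlinarith
        have h4 : (1 + c) ^ 2 + s ≤ boundConst a b s := by
          calc (1 + c) ^ 2 + s ≤ (1 + a) * (1 + b) * (1 + c) + (1 + a) * s := add_le_add h2 h3
            _ = boundConst a b s := by
              simp only [c, boundConst]
              ring
        gcongr

theorem tendsto_sub_wt (h : IsRun F B C L lam α β x w wt w' y v ε) {z : H}
    (hz : ∀ k, z ∈ halfSpace (y k) (v k) (ε k)) (hα : BddAbove (Set.range α))
    (hβ : Summable fun k => β k ^ 2) :
    Tendsto (fun k => ‖x (k + 1) - wt k‖) atTop (𝓝 0) := by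
  have h1 := (summable_of_sum_range_le (fun _ => sq_nonneg _)
    (h.sum_sq_norm_sub_wt_le hz hα hβ)).tendsto_atTop_zero
  simpa using h1.sqrt

theorem tendsto_succ_sub (h : IsRun F B C L lam α β x w wt w' y v ε) {z : H}
    (hz : ∀ k, z ∈ halfSpace (y k) (v k) (ε k)) :
    Tendsto (fun k => ‖x (k + 1) - x k‖) atTop (𝓝 0) := by
  have h1 := (summable_of_sum_range_le (fun _ => sq_nonneg _)
    (h.sum_sq_norm_succ_le hz)).tendsto_atTop_zero
  simpa using h1.sqrt

theorem tendsto_wt_sub_y (h : IsRun F B C L (2 * σ ^ 2 / L) α β x w wt w' y v ε) {z : H}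
    (hz : ∀ k, z ∈ halfSpace (y k) (v k) (ε k)) (hα : BddAbove (Set.range α))
    (hβ : Summable fun k => β k ^ 2)
    (hL : 0 < L) (hσ0 : 0 < σ) (hσ1 : σ < 1) (hC : Convex ℝ C) (hBC : dom B ⊆ C) :
    Tendsto (fun k => ‖wt k - y k‖) atTop (𝓝 0) := by
  have hσ : 0 < 1 - σ ^ 2 := by nlinarith
  have h1 := (h.tendsto_sub_wt hz hα hβ).const_mul (1 - σ ^ 2)⁻¹
  rw [mul_zero] at h1
  refine squeeze_zero (fun _ => norm_nonneg _) (fun k => ?_) h1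
  rw [← div_eq_inv_mul, le_div_iff₀ hσ, mul_comm]
  exact h.norm_wt_sub_y_le hL hσ0 hC hBC k

theorem tendsto_y_sub_x (h : IsRun F B C L (2 * σ ^ 2 / L) α β x w wt w' y v ε) {z : H}
    (hz : ∀ k, z ∈ halfSpace (y k) (v k) (ε k)) (hα : BddAbove (Set.range α))
    (hβ : Summable fun k => β k ^ 2)
    (hL : 0 < L) (hσ0 : 0 < σ) (hσ1 : σ < 1) (hC : Convex ℝ C) (hBC : dom B ⊆ C) :
    Tendsto (fun k => y k - x k) atTop (𝓝 0) := by
  have h1 := ((tendsto_zero_iff_norm_tendsto_zero.2 (h.tendsto_succ_sub hz)).sub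
    (tendsto_zero_iff_norm_tendsto_zero.2 (h.tendsto_sub_wt hz hα hβ))).sub
    (tendsto_zero_iff_norm_tendsto_zero.2
      (h.tendsto_wt_sub_y hz hα hβ hL hσ0 hσ1 hC hBC))
  simp only [sub_zero] at h1
  refine h1.congr fun k => ?_
  abel

/-! ### Weak limits of the iterates are solutions -/

/-- The forward steps converge strongly to the common value of `F` on the solution set. -/
theorem tendsto_F_y (h : IsRun F B C L (2 * σ ^ 2 / L) α β x w wt w' y v ε)
    (hF : IsCocoercive F L) (hB : IsMonotone B) {z : H} (hz : z ∈ zeros (single F + B))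
    (hα : BddAbove (Set.range α)) (hβ : Summable fun k => β k ^ 2)
    (hL : 0 < L) (hσ0 : 0 < σ) (hσ1 : σ < 1) (hC : Convex ℝ C) (hBC : dom B ⊆ C) :
    Tendsto (fun k => F (y k)) atTop (𝓝 (F z)) ∧
      Tendsto (fun k => v k - F (w' k)) atTop (𝓝 (-F z)) := by
  have hlam : 0 < 2 * σ ^ 2 / L := by positivity
  have hH := h.mem_halfSpace hlam.ne' hL hF hB hz
  have hwy := h.tendsto_wt_sub_y hH hα hβ hL hσ0 hσ1 hC hBC
  have hv : Tendsto v atTop (𝓝 0) := by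
    rw [tendsto_zero_iff_norm_tendsto_zero]
    simp only [h.norm_v_eq hlam]
    simpa only [mul_zero] using hwy.const_mul (2 * σ ^ 2 / L)⁻¹
  have hFw : Tendsto (fun k => F (y k) - F (w' k)) atTop (𝓝 0) := by
    rw [tendsto_zero_iff_norm_tendsto_zero]
    refine squeeze_zero (fun _ => norm_nonneg _) (fun k => ?_)
      (by simpa using hwy.const_mul L)
    exact (hF.norm_sub_le hL _ _).trans
      (mul_le_mul_of_nonneg_left (h.norm_y_sub_w'_le hlam.ne' hC hBC k) hL.le)
  -- This residual is an element of `(F + B)(y k)`. Pairing it with the bounded `y k - z` dominates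
  -- `1 / L * ‖F (y k) - F z‖ ^ 2`, as `B` contributes a nonnegative term.
  have hr : Tendsto (fun k => v k + (F (y k) - F (w' k))) atTop (𝓝 0) := by
    simpa using hv.add hFw
  obtain ⟨R, hR⟩ : ∃ R, ∀ k, ‖y k - z‖ ≤ R := by
    obtain ⟨M, hM⟩ := (Metric.isBounded_range_of_tendsto _
      (h.tendsto_y_sub_x hH hα hβ hL hσ0 hσ1 hC hBC)).exists_norm_le
    refine ⟨M + ‖x 0 - z‖ + ‖x 0 - z‖, fun k => ?_⟩
    rw [show y k - z = (y k - x k) + (x k - x 0) + (x 0 - z) by abel]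
    refine (norm_add₃_le).trans ?_
    have h1 := hM _ ⟨k, rfl⟩
    have h2 := h.norm_sub_start_le hH k
    gcongr
  have hFy : Tendsto (fun k => F (y k)) atTop (𝓝 (F z)) := by
    have hsq : Tendsto (fun k => ‖F (y k) - F z‖ ^ 2) atTop (𝓝 0) := by
      have hlim : Tendsto (fun k => L * (R * ‖v k + (F (y k) - F (w' k))‖)) atTop (𝓝 0) := by
        simpa using ((tendsto_zero_iff_norm_tendsto_zero.1 hr).const_mul R).const_mul L
      refine squeeze_zero (fun _ => sq_nonneg _) (fun k => ?_) hlim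
      obtain ⟨b, hb, hvb⟩ := h.exists_mem hlam.ne' k
      have h1 := hB (y k) z b hb _ (mem_zeros_iff.1 hz)
      have h2 : 1 / L * ‖F (y k) - F z‖ ^ 2 ≤ _ := hF (y k) z
      have h3 : inner ℝ (y k - z) (v k + (F (y k) - F (w' k))) =
          inner ℝ (y k - z) (b - -F z) + inner ℝ (y k - z) (F (y k) - F z) := by
        rw [← inner_add_right, hvb]
        congr 1
        abel
      have h4 := (real_inner_le_norm (y k - z) (v k + (F (y k) - F (w' k)))).trans
        (mul_le_mul_of_nonneg_right (hR k) (norm_nonneg _))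
      have h5 : 1 / L * ‖F (y k) - F z‖ ^ 2 ≤ R * ‖v k + (F (y k) - F (w' k))‖ := by linarith
      rwa [one_div, inv_mul_le_iff₀ hL] at h5
    rw [tendsto_iff_norm_sub_tendsto_zero]
    simpa using hsq.sqrt
  refine ⟨hFy, ?_⟩
  have h1 := hr.sub hFy
  rw [zero_sub] at h1
  refine h1.congr fun k => ?_
  abel

theorem weak_limit_mem_zeros (h : IsRun F B C L (2 * σ ^ 2 / L) α β x w wt w' y v ε)
    (hF : IsCocoercive F L) (hB : IsMaximalMonotone B) {z : H}
    (hz : z ∈ zeros (single F + B))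
    (hα : BddAbove (Set.range α)) (hβ : Summable fun k => β k ^ 2)
    (hL : 0 < L) (hσ0 : 0 < σ) (hσ1 : σ < 1) (hC : Convex ℝ C) (hBC : dom B ⊆ C)
    {l : Filter ℕ} [l.NeBot] (hl : l ≤ atTop) {a : H}
    (ha : ∀ q : H, Tendsto (fun k => inner ℝ (x k - x 0) q) l (𝓝 (inner ℝ (a - x 0) q))) :
    a ∈ zeros (single F + B) := by
  have hlam : 0 < 2 * σ ^ 2 / L := by positivity
  have hH := h.mem_halfSpace hlam.ne' hL hF hB.1 hz
  obtain ⟨hFy, hb⟩ := h.tendsto_F_y hF hB.1 hz hα hβ hL hσ0 hσ1 hC hBC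
  have hyx := h.tendsto_y_sub_x hH hα hβ hL hσ0 hσ1 hC hBC
  -- Along `l`, `y k` inherits the weak limit `a` of `x k`, and weak convergence of a bounded family
  -- pairs with strong convergence.
  have key : ∀ (u c : H) (r : ℕ → H), Tendsto r atTop (𝓝 c) →
      Tendsto (fun k => inner ℝ (u - y k) (r k)) l (𝓝 (inner ℝ (u - a) c)) := by
    intro u c r hr
    have h1 := tendsto_inner_of_weak (h.norm_sub_start_le hH) ha (hr.mono_left hl)
    have h2 : Tendsto (fun k => inner ℝ (y k - x k) (r k)) l (𝓝 (inner ℝ 0 c)) :=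
      (hyx.inner hr).mono_left hl
    have h3 : Tendsto (fun k => inner ℝ (u - x 0) (r k)) l (𝓝 (inner ℝ (u - x 0) c)) :=
      (tendsto_const_nhds.inner hr).mono_left hl
    have h4 := (h3.sub h1).sub h2
    rw [inner_zero_left, sub_zero, ← inner_sub_left, sub_sub_sub_cancel_right] at h4
    refine h4.congr fun k => ?_
    rw [← inner_sub_left, ← inner_sub_left]
    congr 1
    abel
  -- Cocoercivity between `a` and `y k` passes to the limit, where its left-hand side becomes `⟨a -
  -- a, F a - F z⟩`.
  have hFa : F a = F z := by
    have h1 := key a (F a - F z) _ (tendsto_const_nhds.sub hFy)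
    rw [sub_self, inner_zero_left] at h1
    have h2 : Tendsto (fun k => 1 / L * ‖F a - F (y k)‖ ^ 2) l (𝓝 (1 / L * ‖F a - F z‖ ^ 2)) :=
      (((tendsto_const_nhds.sub hFy).norm.pow 2).const_mul _).mono_left hl
    have h3 : 1 / L * ‖F a - F z‖ ^ 2 ≤ 0 := le_of_tendsto_of_tendsto' h2 h1 fun k => hF a (y k)
    exact eq_of_mul_sq_norm_sub_nonpos hL h3
  rw [mem_zeros_iff, hFa]
  refine hB.mem fun u c hc => ?_
  refine ge_of_tendsto' (key u (c - -F z) _ (tendsto_const_nhds.sub hb)) fun k => ?_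
  obtain ⟨b, hb, hvb⟩ := h.exists_mem hlam.ne' k
  rw [hvb, add_sub_cancel_left]
  exact hB.1 u (y k) c hc b hb

/-! ### Strong convergence -/

/-- Expanding around `x 0` bounds `‖x k - p‖ ^ 2` by an expression affine in `x k`, so weak limits
suffice. Its limit is nonpositive by the variational inequality of `p` at the weak limit, which is a
solution. -/
theorem tendsto_x [CompleteSpace H] (h : IsRun F B C L (2 * σ ^ 2 / L) α β x w wt w' y v ε)
    (hF : IsCocoercive F L) (hB : IsMaximalMonotone B) {p : H}
    (hp : IsProj (zeros (single F + B)) (x 0) p)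
    (hα : BddAbove (Set.range α)) (hβ : Summable fun k => β k ^ 2)
    (hL : 0 < L) (hσ0 : 0 < σ) (hσ1 : σ < 1) (hC : Convex ℝ C) (hBC : dom B ⊆ C) :
    Tendsto x atTop (𝓝 p) := by
  have hlam : 0 < 2 * σ ^ 2 / L := by positivity
  have hle := h.norm_sub_start_le (h.mem_halfSpace hlam.ne' hL hF hB.1 hp.1)
  rw [tendsto_iff_ultrafilter]
  intro 𝒰 h𝒰
  obtain ⟨a, ha⟩ := exists_weak_limit 𝒰 (fun k => x k - x 0) _ hle
  have haS : a + x 0 ∈ zeros (single F + B) :=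
    h.weak_limit_mem_zeros hF hB hp.1 hα hβ hL hσ0 hσ1 hC hBC h𝒰 (by simpa using ha)
  have hvar := hp.inner_le_zero (convex_zeros hL hF hB) haS
  have hlim : Tendsto (fun k => 2 * ‖x 0 - p‖ ^ 2 + 2 * inner ℝ (x k - x 0) (x 0 - p)) 𝒰
      (𝓝 (2 * ‖x 0 - p‖ ^ 2 + 2 * inner ℝ a (x 0 - p))) :=
    ((ha (x 0 - p)).const_mul 2).const_add _
  have hneg : 2 * ‖x 0 - p‖ ^ 2 + 2 * inner ℝ a (x 0 - p) ≤ 0 := by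
    rw [show a + x 0 - p = a + (x 0 - p) by abel, inner_add_right, real_inner_comm,
      real_inner_self_eq_norm_sq] at hvar
    linarith
  have hbound : ∀ k, ‖x k - p‖ ^ 2 ≤
      2 * ‖x 0 - p‖ ^ 2 + 2 * inner ℝ (x k - x 0) (x 0 - p) := by
    intro k
    rw [show x k - p = (x k - x 0) + (x 0 - p) by abel, norm_add_sq_real]
    have : ‖x k - x 0‖ ^ 2 ≤ ‖x 0 - p‖ ^ 2 := by
      gcongr
      exact hle k
    linarith
  have hzero : 2 * ‖x 0 - p‖ ^ 2 + 2 * inner ℝ a (x 0 - p) = 0 :=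
    le_antisymm hneg (ge_of_tendsto' hlim fun k => (sq_nonneg _).trans (hbound k))
  rw [hzero] at hlim
  have hsq := squeeze_zero (fun k => sq_nonneg ‖x k - p‖) hbound hlim
  rw [tendsto_iff_norm_sub_tendsto_zero]
  simpa using hsq.sqrt

/-! ### Complexity bounds -/

theorem exists_sq_norm_sub_wt_le (h : IsRun F B C L lam α β x w wt w' y v ε) {z : H}
    (hz : ∀ k, z ∈ halfSpace (y k) (v k) (ε k)) (hα : BddAbove (Set.range α))
    (hβ : Summable fun k => β k ^ 2) (k : ℕ) :
    ∃ j ≤ k, ‖x (j + 1) - wt j‖ ^ 2 ≤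
      2 * boundConst (⨆ i, α i) (⨆ i, β i) (∑' i, β i ^ 2) * ‖x 0 - z‖ ^ 2 / (k + 1) := by
  have h1 : ∑ j ∈ Finset.range (k + 1), ‖x (j + 1) - wt j‖ ^ 2 ≤
      ∑ _j ∈ Finset.range (k + 1),
        2 * boundConst (⨆ i, α i) (⨆ i, β i) (∑' i, β i ^ 2) * ‖x 0 - z‖ ^ 2 / (k + 1) := by
    refine (h.sum_sq_norm_sub_wt_le hz hα hβ (k + 1)).trans_eq ?_
    rw [Finset.sum_const, Finset.card_range, nsmul_eq_mul]
    push_cast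
    field_simp
  obtain ⟨j, hj, hle⟩ := Finset.exists_le_of_sum_le ⟨0, by simp⟩ h1
  exact ⟨j, Nat.lt_succ_iff.1 (Finset.mem_range.1 hj), hle⟩

theorem boundConst_nonneg (h : IsRun F B C L lam α β x w wt w' y v ε) :
    0 ≤ boundConst (⨆ i, α i) (⨆ i, β i) (∑' i, β i ^ 2) := by
  have ha : 0 ≤ ⨆ i, α i := Real.iSup_nonneg h.alpha_nonneg
  have hb : 0 ≤ ⨆ i, β i := Real.iSup_nonneg h.beta_nonneg
  have hs : 0 ≤ ∑' i, β i ^ 2 := tsum_nonneg fun _ => sq_nonneg _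
  unfold boundConst
  positivity

end IsRun

end InertialFB

theorem theorem5p2 {H : Type*} [NormedAddCommGroup H] [InnerProductSpace ℝ H] [CompleteSpace H]
    (F : H → H) (B : H → Set H) (C S : Set H) (L σ : ℝ)
    (hL : 0 < L) (hF : InertialFB.IsCocoercive F L)
    (hB : InertialFB.IsMaximalMonotone B)
    (hCne : C.Nonempty) (hCcl : IsClosed C) (hCconv : Convex ℝ C)
    (hBC : InertialFB.dom B ⊆ C)
    (hS : S = InertialFB.zeros (InertialFB.single F + B)) (hSne : S.Nonempty)
    (hσ0 : 0 < σ) (hσ1 : σ < 1)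
    (α β : ℕ → ℝ) (x w wt w' y v : ℕ → H) (ε : ℕ → ℝ)
    (hrun : InertialFB.IsRun F B C L (2 * σ ^ 2 / L) α β x w wt w' y v ε)
    (hα : BddAbove (Set.range α)) (hβ : Summable fun k => β k ^ 2) :
    ((∃! p, InertialFB.IsProj S (x 0) p) ∧
      ∀ p, InertialFB.IsProj S (x 0) p →
        Tendsto x atTop (𝓝 p) ∧ Tendsto y atTop (𝓝 p)) ∧
    ∀ k : ℕ, ∃ j ≤ k,
      v j ∈ (InertialFB.enlargement (InertialFB.single F) (ε j) + B) (y j) ∧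
      ‖v j‖ ≤ 2 * Metric.infDist (x 0) S * L / √((k : ℝ) + 1) *
        (√(InertialFB.boundConst (⨆ i, α i) (⨆ i, β i) (∑' i, β i ^ 2)) /
          (2 * (1 - σ ^ 2) * σ ^ 2)) ∧
      ε j ≤ Metric.infDist (x 0) S ^ 2 * L / ((k : ℝ) + 1) *
        (4 * σ ^ 2 * InertialFB.boundConst (⨆ i, α i) (⨆ i, β i) (∑' i, β i ^ 2) /
          (2 * (1 - σ ^ 2) ^ 2 * σ ^ 2)) := by
  subst hS
  have hlam : 0 < 2 * σ ^ 2 / L := by positivity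
  have hex := InertialFB.existsUnique_isProj hSne (InertialFB.isClosed_zeros hL hF hB)
    (InertialFB.convex_zeros hL hF hB) (x 0)
  have hH : ∀ p ∈ InertialFB.zeros (InertialFB.single F + B), ∀ k,
      p ∈ InertialFB.halfSpace (y k) (v k) (ε k) :=
    fun p hp => hrun.mem_halfSpace hlam.ne' hL hF hB.1 hp
  refine ⟨⟨hex, fun p hp => ?_⟩, fun k => ?_⟩
  · have hx := hrun.tendsto_x hF hB hp hα hβ hL hσ0 hσ1 hCconv hBC
    refine ⟨hx, ?_⟩
    have h1 := (hrun.tendsto_y_sub_x (hH p hp.1) hα hβ hL hσ0 hσ1 hCconv hBC).add hx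
    simpa using h1
  · obtain ⟨p, hp, -⟩ := hex
    obtain ⟨j, hjk, hj⟩ := hrun.exists_sq_norm_sub_wt_le (hH p hp.1) hα hβ k
    refine ⟨j, hjk, hrun.mem_enlargement_add hlam.ne' hL hF j, ?_⟩
    have hK := hrun.boundConst_nonneg
    rw [hp.infDist_eq]
    set K := InertialFB.boundConst (⨆ i, α i) (⨆ i, β i) (∑' i, β i ^ 2)
    set d := ‖x 0 - p‖
    have hd : 0 ≤ d := norm_nonneg _
    have hσ : 0 < 1 - σ ^ 2 := by nlinarith
    have hwy := hrun.norm_wt_sub_y_le hL hσ0 hCconv hBC j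
    have hwy2 : ‖wt j - y j‖ ^ 2 ≤ 2 * K * d ^ 2 / (k + 1) / (1 - σ ^ 2) ^ 2 := by
      rw [le_div_iff₀ (by positivity), mul_comm, ← mul_pow]
      exact (pow_le_pow_left₀ (by positivity) hwy 2).trans hj
    constructor
    -- The stated constant leaves slack: the factor `√2` available from `hwy2` is relaxed to `2`.
    · have h1 : ‖wt j - y j‖ ≤ 2 * (d * √K / √((k : ℝ) + 1) / (1 - σ ^ 2)) := by
        refine (abs_le_of_sq_le_sq' (hwy2.trans ?_) (by positivity)).2
        rw [mul_pow, div_pow, div_pow, mul_pow, Real.sq_sqrt hK, Real.sq_sqrt (by positivity),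
          ← mul_div_assoc, ← mul_div_assoc]
        gcongr ?_ / _ / _
        nlinarith [mul_nonneg hK (sq_nonneg d)]
      rw [hrun.norm_v_eq hlam]
      calc (2 * σ ^ 2 / L)⁻¹ * ‖wt j - y j‖
          ≤ (2 * σ ^ 2 / L)⁻¹ * (2 * (d * √K / √((k : ℝ) + 1) / (1 - σ ^ 2))) := by gcongr
        _ = _ := by field_simp
    · have hyw := hrun.norm_y_sub_w'_le hlam.ne' hCconv hBC j
      calc ε j = L / 4 * ‖y j - w' j‖ ^ 2 := by rw [hrun.ε_eq]; field_simp
        _ ≤ L / 4 * ‖wt j - y j‖ ^ 2 := by gcongr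
        _ ≤ L / 4 * (2 * K * d ^ 2 / (k + 1) / (1 - σ ^ 2) ^ 2) := by gcongr
        -- Here the available factor `L / 2` is relaxed to `2 * L` to match the stated bound.
        _ ≤ 2 * L * (K * d ^ 2 / (k + 1) / (1 - σ ^ 2) ^ 2) := by
          have : 0 ≤ L * (K * d ^ 2 / (k + 1) / (1 - σ ^ 2) ^ 2) := by positivity
          rw [mul_assoc 2 K, mul_div_assoc, mul_div_assoc]
          linarith
        _ = _ := by field_simp; ring
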